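/- Let $d,m,k$ be nonnegative integers with $m\le k$. For a multi-index $\alpha\in\mathbb Z_+^d$ put $c_\alpha=|\alpha|!/(\alpha_1!\cdots\alpha_d!)$, so that $\sum_{|\alpha|=j}c_\alpha x^{2\alpha}=|x|^{2j}$ for all $x\in\mathbb R^d$ and $j\ge 0$. Let $BL^j(\mathbb R^d)$ be the space of all tempered distributions $f$ on $\mathbb R^d$ with $D^\alpha f\in L_2(\mathbb R^d)$ for every $\alpha$ with $|\alpha|=j$, with the seminorm $$|f|_{j,\mathbb R^d}=\Bigl(\sum_{|\alpha|=j}c_\alpha\int_{\mathbb R^d}|(D^\alpha f)(x)|^2\,dx\Bigr)^{1/2}.$$ Let $\varphi\in C_0^\infty(\mathbb R^d)$ (smooth with compact support), and for $h>0$ let $\varphi_h(x)=h^{-d}\varphi(x/h)$. Then there is a constant $C>0$, independent of $h$ and $f$, such that for all $h>0$ and all $f\in BL^m(\mathbb R^d)$ we have $\varphi_h*f\in BL^k(\mathbb R^d)$ and $$|\varphi_h*f|_{k,\mathbb R^d}\le C\,h^{m-k}\,|f|_{m,\mathbb R^d}.$$ Furthermore, if $m<k$, then for every $f\in BL^m(\mathbb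 R^d)$ we have $|\varphi_h*f|_{k,\mathbb R^d}=o(h^{m-k})$ as $h\to 0^+$. -/

import Mathlib

open Filter Topology MeasureTheory Asymptotics
open scoped SchwartzMap LineDeriv ContDiff

namespace BeppoLevi

noncomputable section

/-- Tempered distributions on `ℝ^d`. -/
abbrev Tempered (d : ℕ) : Type := 𝓢'(EuclideanSpace ℝ (Fin d), ℂ)

/-- The multi-indices `α ∈ ℤ₊^d` with `|α| = k`. -/
def multiIndices (d k : ℕ) : Finset (Fin d → ℕ) := Finset.piAntidiag Finset.univ k

theorem mem_multiIndices {d k : ℕ} {α : Fin d → ℕ} : α ∈ multiIndices d k ↔ ∑ i, α i = k := by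
  simp [multiIndices]

/-- The distributional derivative `D^α f = ∂₁^{α₁} ⋯ ∂_d^{α_d} f`. -/
def multiDeriv {d : ℕ} (α : Fin d → ℕ) (f : Tempered d) : Tempered d :=
  (List.finRange d).foldr
    (fun i g ↦ (fun u : Tempered d ↦ ∂_{EuclideanSpace.single i (1 : ℝ)} u)^[α i] g) f

/-- The coefficients `c_α = |α|! / (α₁! ⋯ α_d!)`. They are the only ones that make the
Beppo-Levi seminorm rotationally invariant in the sense of `sum_coeff_mul_prod_pow`. -/
def coeff {d : ℕ} (α : Fin d → ℕ) : ℝ := (Nat.multinomial Finset.univ α : ℝ)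

/-- `∑_{|α| = k} c_α x^{2α} = |x|^{2k}`. -/
theorem sum_coeff_mul_prod_pow (d k : ℕ) (x : EuclideanSpace ℝ (Fin d)) :
    ∑ α ∈ multiIndices d k, coeff α * ∏ i, x i ^ (2 * α i) = ‖x‖ ^ (2 * k) := by
  rw [pow_mul, EuclideanSpace.real_norm_sq_eq, Finset.sum_pow_eq_sum_piAntidiag]
  simp [multiIndices, coeff, pow_mul]

/-- The tempered distribution `u` is (integration against) a square integrable function. -/
def IsL2 {d : ℕ} (u : Tempered d) : Prop :=
  ∃ g : Lp ℂ 2 (volume : Measure (EuclideanSpace ℝ (Fin d))), (g : Tempered d) = u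

open Classical in
/-- The square integrable function that represents `u`; it is unique (see `l2Rep_coe`).
The value is `0` if there is none. -/
def l2Rep {d : ℕ} (u : Tempered d) : Lp ℂ 2 (volume : Measure (EuclideanSpace ℝ (Fin d))) :=
  if hu : IsL2 u then hu.choose else 0

theorem l2Rep_coe {d : ℕ} (g : Lp ℂ 2 (volume : Measure (EuclideanSpace ℝ (Fin d)))) :
    l2Rep (g : Tempered d) = g := by
  have hg : IsL2 (g : Tempered d) := ⟨g, rfl⟩
  rw [l2Rep, dif_pos hg]
  exact LinearMap.ker_eq_bot.1 (Lp.ker_toTemperedDistributionCLM_eq_bot (F := ℂ)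
    (μ := (volume : Measure (EuclideanSpace ℝ (Fin d)))) (p := 2)) hg.choose_spec

/-- The Beppo-Levi space `BL^k(ℝ^d)`: the tempered distributions all of whose derivatives of
order exactly `k` are square integrable. -/
def space (d k : ℕ) : Set (Tempered d) :=
  {f | ∀ α ∈ multiIndices d k, IsL2 (multiDeriv α f)}

/-- The seminorm `|f|_{k,ℝ^d} = (∑_{|α| = k} c_α ∫ |D^α f (x)|² dx)^{1/2}` of `f ∈ BL^k(ℝ^d)`. -/
def seminorm {d : ℕ} (k : ℕ) (f : Tempered d) : ℝ :=
  Real.sqrt (∑ α ∈ multiIndices d k, coeff α * ∫ x, ‖l2Rep (multiDeriv α f) x‖ ^ 2)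

/-- The dilate `φ_h(x) = h^{-d} φ(x / h)` for `h ≠ 0` (and `0` for `h = 0`). -/
def dilate {d : ℕ} (φ : 𝓢(EuclideanSpace ℝ (Fin d), ℂ)) (h : ℝ) :
    𝓢(EuclideanSpace ℝ (Fin d), ℂ) :=
  if hh : h = 0 then 0
  else (h ^ d)⁻¹ • SchwartzMap.compCLMOfContinuousLinearEquiv ℂ
    (ContinuousLinearEquiv.smulLeft (Units.mk0 h⁻¹ (inv_ne_zero hh))) φ

theorem dilate_apply {d : ℕ} (φ : 𝓢(EuclideanSpace ℝ (Fin d), ℂ)) {h : ℝ} (hh : h ≠ 0)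
    (x : EuclideanSpace ℝ (Fin d)) : dilate φ h x = ((h ^ d)⁻¹ : ℝ) • φ (h⁻¹ • x) := by
  simp [dilate, hh, Units.smul_def]

/-- The reflection `φ(-·)`. -/
def reflect {d : ℕ} (φ : 𝓢(EuclideanSpace ℝ (Fin d), ℂ)) : 𝓢(EuclideanSpace ℝ (Fin d), ℂ) :=
  SchwartzMap.compCLMOfContinuousLinearEquiv ℂ (ContinuousLinearEquiv.neg ℝ) φ

/-- The convolution `φ * f` of a Schwartz function and a tempered distribution:
`⟨φ * f, ψ⟩ = ⟨f, φ(-·) * ψ⟩`, where `φ(-·) * ψ` is the convolution of functions. -/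
def conv {d : ℕ} (φ : 𝓢(EuclideanSpace ℝ (Fin d), ℂ)) (f : Tempered d) : Tempered d :=
  PointwiseConvergenceCLM.precomp ℂ
    (SchwartzMap.convolution (ContinuousLinearMap.mul ℂ ℂ) (reflect φ)) f

theorem conv_apply {d : ℕ} (φ : 𝓢(EuclideanSpace ℝ (Fin d), ℂ)) (f : Tempered d)
    (ψ : 𝓢(EuclideanSpace ℝ (Fin d), ℂ)) :
    conv φ f ψ = f (SchwartzMap.convolution (ContinuousLinearMap.mul ℂ ℂ) (reflect φ) ψ) := rfl

end

end BeppoLevi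

/-!
The Fourier transform turns every operation of the statement into a multiplication. On tempered
distributions `φ * ·` is the Fourier multiplier with symbol `𝓕 φ` (`conv_eq_fourierMultiplierCLM`)
and `∂_v` is the multiplier with symbol `2πi ⟨ξ, v⟩`, so that derivatives may be moved freely between
the factors of a convolution: `D^β (φ * f) = (D^(β-α) φ) * D^α f` for `α ≤ β` (`multiDeriv_conv`).

Choose for each `β` of order `k` some `α ≤ β` of order `m`, and put `γ = β - α`, `ψ = D^γ φ`,
`g = D^α f ∈ L²`. Since `𝓕 (D^γ φ_h) ξ = h^(-|γ|) 𝓕 ψ (hξ)` and `|γ| = k - m`, Plancherel's theorem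
gives `‖D^β (φ_h * f)‖² = h^(2(m-k)) ∫ |𝓕 ψ (hξ)|² |𝓕 g ξ|² dξ` (`multiDeriv_conv_dilate`). The
integral is at most `(sup |𝓕 ψ|)² ‖g‖²`, which is the estimate. If `m < k`, then `𝓕 ψ 0 = 0`, as `ψ`
is a derivative of positive order; hence the integral tends to `0` with `h` by dominated
convergence (`tendsto_mollifiedEnergy`), which is the `o` statement.
-/

open scoped FourierTransform

namespace BeppoLevi

variable {d : ℕ}

local notation "𝔼" => EuclideanSpace ℝ (Fin d)

/-! ### Convolution as a Fourier multiplier -/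

theorem fourier_reflect (φ : 𝓢(𝔼, ℂ)) : 𝓕 (reflect φ) = 𝓕⁻ φ := by
  ext x
  rw [SchwartzMap.fourier_coe, SchwartzMap.fourierInv_coe, Real.fourierInv_eq_fourier_comp_neg]
  rfl

theorem reflect_reflect (φ : 𝓢(𝔼, ℂ)) : reflect (reflect φ) = φ := by
  ext x
  simp [reflect]

/-- Convolution with `φ` is the Fourier multiplier with symbol `𝓕 φ`. The reflection in the definition
of `conv` by duality matches the reflection between `𝓕` and `𝓕⁻`. -/
theorem conv_eq_fourierMultiplierCLM (φ : 𝓢(𝔼, ℂ)) (f : Tempered d) :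
    conv φ f = TemperedDistribution.fourierMultiplierCLM ℂ (𝓕 φ : 𝓢(𝔼, ℂ)) f := by
  ext u
  rw [conv_apply, TemperedDistribution.fourierMultiplierCLM_apply_apply]
  congr 1
  rw [← reflect_reflect (SchwartzMap.smulLeftCLM ℂ (𝓕 φ : 𝓢(𝔼, ℂ)) (𝓕⁻ u)), fourier_reflect]
  rw [← FourierTransform.fourierInv_fourier_eq (F := 𝓢(𝔼, ℂ))
    (SchwartzMap.convolution (ContinuousLinearMap.mul ℂ ℂ) (reflect φ) u),
    SchwartzMap.fourier_convolution, fourier_reflect]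
  congr 1
  ext x
  simp [reflect, SchwartzMap.smulLeftCLM_apply_apply (SchwartzMap.hasTemperateGrowth _),
    SchwartzMap.fourierInv_apply_eq]

theorem fourier_lineDerivOp_apply (φ : 𝓢(𝔼, ℂ)) (v ξ : 𝔼) :
    𝓕 (∂_{v} φ) ξ = 2 * Real.pi * Complex.I * (inner ℝ ξ v : ℝ) * 𝓕 φ ξ := by
  have : (inner ℝ · v : 𝔼 → ℝ).HasTemperateGrowth := by fun_prop
  rw [SchwartzMap.fourier_lineDerivOp_eq]
  simp [SchwartzMap.smulLeftCLM_apply_apply this, mul_assoc]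

theorem lineDerivOp_eq_fourierMultiplierCLM (v : 𝔼) (f : Tempered d) :
    ∂_{v} f = TemperedDistribution.fourierMultiplierCLM ℂ
      ((2 * Real.pi * Complex.I) • fun ξ : 𝔼 ↦ ((inner ℝ ξ v : ℝ) : ℂ)) f := by
  rw [TemperedDistribution.lineDeriv_eq_fourierMultiplierCLM,
    TemperedDistribution.fourierMultiplierCLM_smul (by fun_prop)]
  rfl

theorem lineDerivOp_conv_left (φ : 𝓢(𝔼, ℂ)) (v : 𝔼) (f : Tempered d) :
    ∂_{v} (conv φ f) = conv (∂_{v} φ) f := by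
  have h : ((2 * Real.pi * Complex.I) •
      fun ξ : 𝔼 ↦ ((inner ℝ ξ v : ℝ) : ℂ)).HasTemperateGrowth := by fun_prop
  rw [lineDerivOp_eq_fourierMultiplierCLM, conv_eq_fourierMultiplierCLM,
    conv_eq_fourierMultiplierCLM,
    TemperedDistribution.fourierMultiplierCLM_fourierMultiplierCLM_apply
      (SchwartzMap.hasTemperateGrowth _) h]
  congr 2
  ext ξ
  rw [fourier_lineDerivOp_apply]
  simp
  ring

theorem lineDerivOp_conv_right (φ : 𝓢(𝔼, ℂ)) (v : 𝔼) (f : Tempered d) :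
    ∂_{v} (conv φ f) = conv φ (∂_{v} f) := by
  have h : ((2 * Real.pi * Complex.I) •
      fun ξ : 𝔼 ↦ ((inner ℝ ξ v : ℝ) : ℂ)).HasTemperateGrowth := by fun_prop
  simp only [lineDerivOp_eq_fourierMultiplierCLM, conv_eq_fourierMultiplierCLM]
  rw [TemperedDistribution.fourierMultiplierCLM_fourierMultiplierCLM_apply
      (SchwartzMap.hasTemperateGrowth _) h,
    TemperedDistribution.fourierMultiplierCLM_fourierMultiplierCLM_apply h
      (SchwartzMap.hasTemperateGrowth _), mul_comm]

/-! ### Derivatives and dilations of the kernel -/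

/-- The derivative `D^γ φ` of a Schwartz function, with the partial derivatives taken in the same
order as in `multiDeriv`. -/
noncomputable def schwartzMultiDeriv (γ : Fin d → ℕ) (φ : 𝓢(𝔼, ℂ)) : 𝓢(𝔼, ℂ) :=
  (List.finRange d).foldr
    (fun i g ↦ (fun u : 𝓢(𝔼, ℂ) ↦ ∂_{EuclideanSpace.single i (1 : ℝ)} u)^[γ i] g) φ

/-- A derivative of a convolution can be split between the two factors. The partial derivatives are
distributed one direction at a time, so their symmetry is not needed. -/
theorem multiDeriv_conv {α β : Fin d → ℕ} (hαβ : α ≤ β) (φ : 𝓢(𝔼, ℂ)) (f : Tempered d) :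
    multiDeriv β (conv φ f) = conv (schwartzMultiDeriv (β - α) φ) (multiDeriv α f) := by
  -- `n` derivatives of a convolution may all be put on the left factor, or all on the right one.
  have left (v : 𝔼) (n : ℕ) (φ : 𝓢(𝔼, ℂ)) (f : Tempered d) :
      (fun u : Tempered d ↦ ∂_{v} u)^[n] (conv φ f) =
        conv ((fun u : 𝓢(𝔼, ℂ) ↦ ∂_{v} u)^[n] φ) f := by
    induction n with
    | zero => rfl
    | succ n ih => simp only [Function.iterate_succ_apply', ih, lineDerivOp_conv_left]
  have right (v : 𝔼) (n : ℕ) (φ : 𝓢(𝔼, ℂ)) (f : Tempered d) :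
      (fun u : Tempered d ↦ ∂_{v} u)^[n] (conv φ f) =
        conv φ ((fun u : Tempered d ↦ ∂_{v} u)^[n] f) := by
    induction n with
    | zero => rfl
    | succ n ih => simp only [Function.iterate_succ_apply', ih, lineDerivOp_conv_right]
  rw [multiDeriv, multiDeriv, schwartzMultiDeriv]
  induction List.finRange d with
  | nil => rfl
  | cons i l ih =>
    simp only [List.foldr_cons, ih]
    rw [← Nat.sub_add_cancel (hαβ i), Function.iterate_add_apply, right, left]
    simp

theorem fourier_schwartzMultiDeriv (γ : Fin d → ℕ) (φ : 𝓢(𝔼, ℂ)) (ξ : 𝔼) :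
    𝓕 (schwartzMultiDeriv γ φ) ξ =
      (∏ i, (2 * Real.pi * Complex.I * (ξ i : ℂ)) ^ γ i) * 𝓕 φ ξ := by
  have iter (i : Fin d) (n : ℕ) (φ : 𝓢(𝔼, ℂ)) :
      𝓕 ((fun u : 𝓢(𝔼, ℂ) ↦ ∂_{EuclideanSpace.single i (1 : ℝ)} u)^[n] φ) ξ =
        (2 * Real.pi * Complex.I * (ξ i : ℂ)) ^ n * 𝓕 φ ξ := by
    induction n with
    | zero => simp
    | succ n ih =>
      rw [Function.iterate_succ_apply', fourier_lineDerivOp_apply, ih,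
        EuclideanSpace.inner_single_right]
      simp
      ring
  rw [schwartzMultiDeriv, Fin.prod_univ_def]
  induction List.finRange d with
  | nil => simp
  | cons i l ih => rw [List.foldr_cons, iter, ih, List.map_cons, List.prod_cons]; ring

theorem fourier_dilate (φ : 𝓢(𝔼, ℂ)) {h : ℝ} (hh : 0 < h) (ξ : 𝔼) :
    𝓕 (dilate φ h) ξ = 𝓕 φ (h • ξ) := by
  rw [SchwartzMap.fourier_coe, SchwartzMap.fourier_coe, Real.fourier_eq, Real.fourier_eq]
  have key := Measure.integral_comp_inv_smul_of_nonneg (volume : Measure 𝔼)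
    (fun v ↦ Real.fourierChar (-inner ℝ v (h • ξ)) • φ v) hh.le
  have hinner (v : 𝔼) : inner ℝ (h⁻¹ • v) (h • ξ) = (inner ℝ v ξ : ℝ) := by
    rw [real_inner_smul_left, real_inner_smul_right, inv_mul_cancel_left₀ hh.ne']
  simp only [hinner, finrank_euclideanSpace, Fintype.card_fin] at key
  simp only [dilate_apply φ hh.ne', smul_comm _ ((h ^ d)⁻¹ : ℝ), integral_smul, key]
  rw [smul_smul, inv_mul_cancel₀ (by positivity), one_smul]

theorem fourier_schwartzMultiDeriv_dilate (γ : Fin d → ℕ) (φ : 𝓢(𝔼, ℂ)) {h : ℝ} (hh : 0 < h)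
    (ξ : 𝔼) :
    𝓕 (schwartzMultiDeriv γ (dilate φ h)) ξ =
      ((h ^ (∑ i, γ i))⁻¹ : ℝ) * 𝓕 (schwartzMultiDeriv γ φ) (h • ξ) := by
  have hc : (h : ℂ) ≠ 0 := by exact_mod_cast hh.ne'
  rw [fourier_schwartzMultiDeriv, fourier_schwartzMultiDeriv, fourier_dilate φ hh]
  have : ∏ i, (2 * Real.pi * Complex.I * (((h • ξ) i : ℝ) : ℂ)) ^ γ i =
      (h : ℂ) ^ (∑ i, γ i) * ∏ i, (2 * Real.pi * Complex.I * (ξ i : ℂ)) ^ γ i := by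
    rw [← Finset.prod_pow_eq_pow_sum, ← Finset.prod_mul_distrib]
    refine Finset.prod_congr rfl fun i _ ↦ ?_
    rw [← mul_pow]
    simp
    ring
  rw [this]
  push_cast
  field_simp

theorem fourier_schwartzMultiDeriv_zero {γ : Fin d → ℕ} (hγ : 0 < ∑ i, γ i) (φ : 𝓢(𝔼, ℂ)) :
    𝓕 (schwartzMultiDeriv γ φ) 0 = 0 := by
  obtain ⟨i, -, hi⟩ := Finset.sum_pos_iff.1 hγ
  rw [fourier_schwartzMultiDeriv, Finset.prod_eq_zero (Finset.mem_univ i), zero_mul]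
  simp [hi.ne']

/-! ### Convolution of a Schwartz function with a square integrable function -/

theorem integral_norm_sq_eq_norm_sq (g : Lp ℂ 2 (volume : Measure 𝔼)) :
    ∫ x, ‖g x‖ ^ 2 = ‖g‖ ^ 2 := by
  have := @inner_self_eq_norm_sq ℂ _ _ _ _ g
  rw [← this, L2.inner_def]
  simp [inner_self_eq_norm_sq_to_K, ← Complex.ofReal_pow, integral_complex_ofReal]

theorem integrable_norm_sq (g : Lp ℂ 2 (volume : Measure 𝔼)) :
    Integrable fun x ↦ ‖g x‖ ^ 2 :=
  (memLp_two_iff_integrable_sq_norm (Lp.aestronglyMeasurable g)).1 (Lp.memLp g)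

/-- The convolution of a Schwartz function with `g ∈ L²` is again in `L²`: it is the inverse Fourier
transform of the product of the bounded function `𝓕 φ` with `𝓕 g`. -/
theorem conv_coe (φ : 𝓢(𝔼, ℂ)) (g : Lp ℂ 2 (volume : Measure 𝔼)) :
    conv φ (g : Tempered d) =
      ((𝓕⁻ (((𝓕 φ).memLp_top.toLp _ • 𝓕 g : Lp ℂ 2 (volume : Measure 𝔼))) :
        Lp ℂ 2 (volume : Measure 𝔼)) : Tempered d) := by
  rw [conv_eq_fourierMultiplierCLM, TemperedDistribution.fourierMultiplierCLM_apply,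
    Lp.fourier_toTemperedDistribution_eq,
    ← Lp.toTemperedDistribution_smul_eq (r := 2) (SchwartzMap.hasTemperateGrowth _)
      ((𝓕 φ).memLp_top), Lp.fourierInv_toTemperedDistribution_eq]

theorem isL2_conv {u : Tempered d} (hu : IsL2 u) (φ : 𝓢(𝔼, ℂ)) : IsL2 (conv φ u) := by
  obtain ⟨g, rfl⟩ := hu
  exact ⟨_, (conv_coe φ g).symm⟩

theorem integral_norm_sq_l2Rep_conv {u : Tempered d} (hu : IsL2 u) (φ : 𝓢(𝔼, ℂ)) :
    ∫ x, ‖l2Rep (conv φ u) x‖ ^ 2 =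
      ∫ ξ, ‖𝓕 φ ξ‖ ^ 2 * ‖(𝓕 (l2Rep u) : Lp ℂ 2 (volume : Measure 𝔼)) ξ‖ ^ 2 := by
  obtain ⟨g, rfl⟩ := hu
  rw [conv_coe, l2Rep_coe, l2Rep_coe, integral_norm_sq_eq_norm_sq,
    ← Lp.norm_fourier_eq, FourierTransform.fourier_fourierInv_eq, ← integral_norm_sq_eq_norm_sq]
  refine integral_congr_ae ?_
  filter_upwards [Lp.coeFn_lpSMul (r := 2) ((𝓕 φ).memLp_top.toLp _) (𝓕 g),
    ((𝓕 φ).memLp_top (μ := volume)).coeFn_toLp] with ξ h₁ h₂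
  rw [h₁, Pi.smul_apply', h₂, norm_smul, mul_pow]

/-! ### Multi-indices and the seminorm -/

theorem sum_sub_add_sum {α β : Fin d → ℕ} (hαβ : α ≤ β) :
    ∑ i, (β - α) i + ∑ i, α i = ∑ i, β i := by
  rw [← Finset.sum_add_distrib]
  exact Finset.sum_congr rfl fun j _ ↦ Nat.sub_add_cancel (hαβ j)

/-- A partial derivative of order `k` contains one of each lower order `m`. -/
theorem exists_le_mem_multiIndices {m k : ℕ} (hmk : m ≤ k) {β : Fin d → ℕ}
    (hβ : β ∈ multiIndices d k) : ∃ α ∈ multiIndices d m, α ≤ β := by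
  induction k, hmk using Nat.le_induction generalizing β with
  | base => exact ⟨β, hβ, le_rfl⟩
  | succ k _ ih =>
    rw [mem_multiIndices] at hβ
    obtain ⟨i, -, hi⟩ := Finset.sum_pos_iff.1 (hβ ▸ k.succ_pos : 0 < ∑ i, β i)
    have hle : Pi.single i 1 ≤ β := by
      intro j
      rcases eq_or_ne j i with rfl | hj
      · simpa using Nat.succ_le_of_lt hi
      · simp [hj]
    have hsum := sum_sub_add_sum hle
    simp only [Finset.sum_pi_single', Finset.mem_univ, if_true, hβ] at hsum
    obtain ⟨α, hα, hαβ⟩ := ih (mem_multiIndices.2 (Nat.succ.inj hsum))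
    exact ⟨α, hα, hαβ.trans tsub_le_self⟩

theorem one_le_coeff (α : Fin d → ℕ) : 1 ≤ coeff α := by
  unfold coeff
  exact_mod_cast Nat.multinomial_pos _ _

theorem coeff_nonneg (α : Fin d → ℕ) : 0 ≤ coeff α := zero_le_one.trans (one_le_coeff α)

/-- A single derivative is controlled by the seminorm, because `c_α ≥ 1`. -/
theorem integral_norm_sq_l2Rep_le_seminorm_sq {m : ℕ} {α : Fin d → ℕ} (hα : α ∈ multiIndices d m)
    (f : Tempered d) : ∫ x, ‖l2Rep (multiDeriv α f) x‖ ^ 2 ≤ seminorm m f ^ 2 := by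
  have h0 (α : Fin d → ℕ) : 0 ≤ ∫ x, ‖l2Rep (multiDeriv α f) x‖ ^ 2 :=
    integral_nonneg fun x ↦ by positivity
  rw [seminorm, Real.sq_sqrt (Finset.sum_nonneg fun α _ ↦ mul_nonneg (coeff_nonneg α) (h0 α))]
  exact (le_mul_of_one_le_left (h0 α) (one_le_coeff α)).trans
    (Finset.single_le_sum (f := fun α ↦ coeff α * ∫ x, ‖l2Rep (multiDeriv α f) x‖ ^ 2)
      (fun α _ ↦ mul_nonneg (coeff_nonneg α) (h0 α)) hα)

/-! ### Mollification of a square integrable function -/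

/-- The energy `‖ψ_h * g‖²` of the mollification of `g` by the dilate `ψ_h`, written on the Fourier
side as `∫ |𝓕 ψ (hξ)|² |𝓕 g ξ|² dξ`. -/
noncomputable def mollifiedEnergy (ψ : 𝓢(𝔼, ℂ)) (g : Lp ℂ 2 (volume : Measure 𝔼)) (h : ℝ) : ℝ :=
  ∫ ξ, ‖𝓕 ψ (h • ξ)‖ ^ 2 * ‖(𝓕 g : Lp ℂ 2 (volume : Measure 𝔼)) ξ‖ ^ 2

theorem norm_fourier_sq_mul_le (ψ : 𝓢(𝔼, ℂ)) (ξ : 𝔼) {t : ℝ} (ht : 0 ≤ t) :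
    ‖𝓕 ψ ξ‖ ^ 2 * t ≤ SchwartzMap.seminorm ℝ 0 0 (𝓕 ψ) ^ 2 * t := by
  gcongr
  exact SchwartzMap.norm_le_seminorm ℝ _ _

theorem mollifiedEnergy_le (ψ : 𝓢(𝔼, ℂ)) (g : Lp ℂ 2 (volume : Measure 𝔼)) (h : ℝ) :
    mollifiedEnergy ψ g h ≤ SchwartzMap.seminorm ℝ 0 0 (𝓕 ψ) ^ 2 * ∫ x, ‖g x‖ ^ 2 := by
  rw [integral_norm_sq_eq_norm_sq, ← Lp.norm_fourier_eq, ← integral_norm_sq_eq_norm_sq,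
    ← integral_const_mul]
  exact integral_mono_of_nonneg (ae_of_all _ fun ξ ↦ by positivity)
    ((integrable_norm_sq _).const_mul _)
    (ae_of_all _ fun ξ ↦ norm_fourier_sq_mul_le ψ _ (by positivity))

/-- If `𝓕 ψ 0 = ∫ ψ` vanishes, the mollifications `ψ_h * g` tend to `0` in `L²`. The energy makes sense
for every real `h`, so that the limit may be taken along the full neighbourhood of `0`. -/
theorem tendsto_mollifiedEnergy {ψ : 𝓢(𝔼, ℂ)} (hψ : 𝓕 ψ 0 = 0)
    (g : Lp ℂ 2 (volume : Measure 𝔼)) :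
    Tendsto (mollifiedEnergy ψ g) (𝓝 0) (𝓝 0) := by
  rw [show (0 : ℝ) = ∫ _ : 𝔼, (0 : ℝ) by simp]
  refine tendsto_integral_filter_of_dominated_convergence
    (fun ξ ↦ SchwartzMap.seminorm ℝ 0 0 (𝓕 ψ) ^ 2 *
      ‖(𝓕 g : Lp ℂ 2 (volume : Measure 𝔼)) ξ‖ ^ 2) (Eventually.of_forall fun h ↦ ?_)
    (Eventually.of_forall fun h ↦ ae_of_all _ fun ξ ↦ ?_) ((integrable_norm_sq _).const_mul _)
    (ae_of_all _ fun ξ ↦ ?_)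
  · exact (((𝓕 ψ).continuous.comp (continuous_const_smul h)).norm.pow 2).aestronglyMeasurable.mul
      (integrable_norm_sq _).aestronglyMeasurable
  · rw [Real.norm_of_nonneg (by positivity)]
    exact norm_fourier_sq_mul_le ψ _ (by positivity)
  · have : Continuous fun h : ℝ ↦
        ‖𝓕 ψ (h • ξ)‖ ^ 2 * ‖(𝓕 g : Lp ℂ 2 (volume : Measure 𝔼)) ξ‖ ^ 2 :=
      (((𝓕 ψ).continuous.comp (continuous_id.smul continuous_const)).norm.pow 2).mul
        continuous_const
    simpa [hψ] using this.tendsto 0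

/-- The derivative `D^β (φ_h * f)` is square integrable, and the scaling in `h` of its norm. -/
theorem multiDeriv_conv_dilate {m k : ℕ} {α β : Fin d → ℕ} (hα : α ∈ multiIndices d m)
    (hβ : β ∈ multiIndices d k) (hαβ : α ≤ β) (φ : 𝓢(𝔼, ℂ)) {f : Tempered d}
    (hf : IsL2 (multiDeriv α f)) {h : ℝ} (hh : 0 < h) :
    IsL2 (multiDeriv β (conv (dilate φ h) f)) ∧
    ∫ x, ‖l2Rep (multiDeriv β (conv (dilate φ h) f)) x‖ ^ 2 =
      (h ^ ((m : ℤ) - (k : ℤ))) ^ 2 *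
        mollifiedEnergy (schwartzMultiDeriv (β - α) φ) (l2Rep (multiDeriv α f)) h := by
  rw [multiDeriv_conv hαβ]
  refine ⟨isL2_conv hf _, ?_⟩
  have hsum : ∑ i, (β - α) i + m = k := by
    rw [← mem_multiIndices.1 hα, ← mem_multiIndices.1 hβ, sum_sub_add_sum hαβ]
  have hpow : h ^ ((m : ℤ) - (k : ℤ)) = (h ^ (∑ i, (β - α) i))⁻¹ := by
    rw [← zpow_natCast, ← zpow_neg]
    congr 1
    omega
  rw [integral_norm_sq_l2Rep_conv hf, mollifiedEnergy, ← integral_const_mul, hpow]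
  refine integral_congr_ae (ae_of_all _ fun ξ ↦ ?_)
  simp only [fourier_schwartzMultiDeriv_dilate _ _ hh, norm_mul, Complex.norm_real, mul_pow]
  rw [Real.norm_of_nonneg (by positivity), mul_assoc]

/-- For any choice of `α β ≤ β` of order `m`, the seminorm of order `k` of a mollification is
`h^(m-k)` times a quantity that involves `h` only through the mollified energies. -/
theorem seminorm_conv_dilate {m k : ℕ} {α : (Fin d → ℕ) → Fin d → ℕ}
    (hα : ∀ β ∈ multiIndices d k, α β ∈ multiIndices d m)
    (hαβ : ∀ β ∈ multiIndices d k, α β ≤ β) (φ : 𝓢(𝔼, ℂ)) {f : Tempered d} (hf : f ∈ space d m)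
    {h : ℝ} (hh : 0 < h) :
    seminorm k (conv (dilate φ h) f) = h ^ ((m : ℤ) - (k : ℤ)) *
      √(∑ β ∈ multiIndices d k, coeff β *
        mollifiedEnergy (schwartzMultiDeriv (β - α β) φ) (l2Rep (multiDeriv (α β) f)) h) := by
  have hp := (zpow_pos hh ((m : ℤ) - (k : ℤ))).le
  nth_rewrite 1 [← Real.sqrt_sq hp]
  rw [seminorm, ← Real.sqrt_mul (sq_nonneg _), Finset.mul_sum]
  congr 1
  refine Finset.sum_congr rfl fun β hβ ↦ ?_
  rw [(multiDeriv_conv_dilate (hα β hβ) hβ (hαβ β hβ) φ (hf _ (hα β hβ)) hh).2]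
  ring

end BeppoLevi

theorem lemma3p1 (d m k : ℕ) (hmk : m ≤ k) (φ : EuclideanSpace ℝ (Fin d) → ℂ)
    (hφ : ContDiff ℝ ∞ φ) (hφc : HasCompactSupport φ) :
    (∃ C : ℝ, 0 < C ∧ ∀ h : ℝ, 0 < h → ∀ f ∈ BeppoLevi.space d m,
      BeppoLevi.conv (BeppoLevi.dilate (hφc.toSchwartzMap hφ) h) f ∈ BeppoLevi.space d k ∧
      BeppoLevi.seminorm k (BeppoLevi.conv (BeppoLevi.dilate (hφc.toSchwartzMap hφ) h) f)
        ≤ C * h ^ ((m : ℤ) - (k : ℤ)) * BeppoLevi.seminorm m f) ∧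
    (m < k → ∀ f ∈ BeppoLevi.space d m,
      (fun h : ℝ ↦
        BeppoLevi.seminorm k (BeppoLevi.conv (BeppoLevi.dilate (hφc.toSchwartzMap hφ) h) f))
        =o[𝓝[>] 0] fun h : ℝ ↦ h ^ ((m : ℤ) - (k : ℤ))) := by
  set Φ := hφc.toSchwartzMap hφ
  choose! α hα hαβ using fun β (hβ : β ∈ BeppoLevi.multiIndices d k) ↦
    BeppoLevi.exists_le_mem_multiIndices hmk hβ
  refine ⟨?_, fun hlt f hf ↦ ?_⟩
  -- The constant comes from `sup |𝓕 (D^γ φ)|`; adding `1` makes it positive.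
  · set S : ℝ := ∑ β ∈ BeppoLevi.multiIndices d k, BeppoLevi.coeff β *
      SchwartzMap.seminorm ℝ 0 0 (𝓕 (BeppoLevi.schwartzMultiDeriv (β - α β) Φ)) ^ 2
    have hsemi (f : BeppoLevi.Tempered d) : 0 ≤ BeppoLevi.seminorm m f := Real.sqrt_nonneg _
    refine ⟨√S + 1, by positivity, fun h hh f hf ↦ ⟨fun β hβ ↦
      (BeppoLevi.multiDeriv_conv_dilate (hα β hβ) hβ (hαβ β hβ) Φ (hf _ (hα β hβ)) hh).1, ?_⟩⟩
    have hbound : √(∑ β ∈ BeppoLevi.multiIndices d k, BeppoLevi.coeff β *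
        BeppoLevi.mollifiedEnergy (BeppoLevi.schwartzMultiDeriv (β - α β) Φ)
          (BeppoLevi.l2Rep (BeppoLevi.multiDeriv (α β) f)) h) ≤
        √S * BeppoLevi.seminorm m f := by
      nth_rewrite 1 [← Real.sqrt_sq (hsemi f)]
      rw [← Real.sqrt_mul' _ (sq_nonneg _), Finset.sum_mul]
      refine Real.sqrt_le_sqrt (Finset.sum_le_sum fun β hβ ↦ ?_)
      rw [mul_assoc]
      refine mul_le_mul_of_nonneg_left ((BeppoLevi.mollifiedEnergy_le _ _ _).trans ?_)
        (BeppoLevi.coeff_nonneg β)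
      exact mul_le_mul_of_nonneg_left
        (BeppoLevi.integral_norm_sq_l2Rep_le_seminorm_sq (hα β hβ) f) (sq_nonneg _)
    have hp := (zpow_pos hh ((m : ℤ) - (k : ℤ))).le
    rw [BeppoLevi.seminorm_conv_dilate hα hαβ Φ hf hh]
    calc _ ≤ h ^ ((m : ℤ) - (k : ℤ)) * ((√S + 1) * BeppoLevi.seminorm m f) :=
          mul_le_mul_of_nonneg_left (hbound.trans
            (mul_le_mul_of_nonneg_right (by linarith) (hsemi f))) hp
      _ = _ := by ring
  · have hlim : Tendsto (fun h : ℝ ↦ √(∑ β ∈ BeppoLevi.multiIndices d k, BeppoLevi.coeff β *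
        BeppoLevi.mollifiedEnergy (BeppoLevi.schwartzMultiDeriv (β - α β) Φ)
          (BeppoLevi.l2Rep (BeppoLevi.multiDeriv (α β) f)) h)) (𝓝[>] 0) (𝓝 0) := by
      have hsum := tendsto_finsetSum (BeppoLevi.multiIndices d k) fun β hβ ↦
        (BeppoLevi.tendsto_mollifiedEnergy (BeppoLevi.fourier_schwartzMultiDeriv_zero
          (γ := β - α β) (by
            have := BeppoLevi.sum_sub_add_sum (hαβ β hβ)
            rw [BeppoLevi.mem_multiIndices.1 hβ, BeppoLevi.mem_multiIndices.1 (hα β hβ)] at this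
            omega) Φ) (BeppoLevi.l2Rep (BeppoLevi.multiDeriv (α β) f))).const_mul
              (BeppoLevi.coeff β)
      simpa using (hsum.sqrt).mono_left nhdsWithin_le_nhds
    have hprod := (isBigO_refl (fun h : ℝ ↦ h ^ ((m : ℤ) - (k : ℤ))) (𝓝[>] 0)).mul_isLittleO
      ((isLittleO_one_iff ℝ).2 hlim)
    refine (hprod.congr' ?_ (by simp))
    filter_upwards [self_mem_nhdsWithin] with h hh
    exact (BeppoLevi.seminorm_conv_dilate hα hαβ Φ hf hh).symm
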